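/- An algebra $R$ (commutative with $1$ and without zero divisors) is called real if, whenever $x_1,\dots,x_n\in R$ satisfy $\sum_{j=1}^n x_j^2=0$, one has $x_1=\cdots=x_n=0$. Lemma 2.2. Let $F$ be a real closed field, let $F(i)=F[X]/(X^2+1)$, and let $G$ be a linear algebraic group over $F$, i.e. an affine group scheme of finite type over $F$, such that $G_{F(i)}=F(i)\times_F G$ is connected. Then the coordinate ring $F[G]$ of $G$ over $F$ is a real algebra; that is, $F[G]$ has no zero divisors, and a finite sum of squares in $F[G]$ vanishes only when every term is zero. -/

import Mathlib

open CategoryTheory CategoryTheory.Limits AlgebraicGeometry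
open scoped Polynomial

universe u

/-- A commutative ring `R` (with `1`) is a *real algebra* if it has no zero divisors and a finite
sum of squares in `R` vanishes only when every term is zero. -/
structure IsRealAlgebra (R : Type*) [CommRing R] : Prop where
  isDomain : IsDomain R
  eq_zero_of_sum_sq_eq_zero :
    ∀ (n : ℕ) (x : Fin n → R), ∑ j, x j ^ 2 = 0 → ∀ j, x j = 0

/-- `F(i) = F[X]/(X² + 1)`. It is a field when `-1` is not a square in `F`, in particular when
`F` is real closed. -/
abbrev AdjoinI (F : Type u) [Field F] : Type u :=
  AdjoinRoot (Polynomial.X ^ 2 + 1 : F[X])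

/-- The base change `G_{F(i)} = Spec F(i) ×_{Spec F} G` of a scheme `G` over `F`. -/
noncomputable abbrev baseChangeI {F : Type u} [Field F] (G : Over (Spec (CommRingCat.of F))) :
    Scheme.{u} :=
  pullback (Spec.map (CommRingCat.ofHom (algebraMap F (AdjoinI F)))) G.hom

/-- The coordinate ring `F[G]` of a scheme `G` over `F`: the ring of global sections. -/
noncomputable abbrev coordinateRing {F : Type u} [Field F] (G : Over (Spec (CommRingCat.of F))) :
    CommRingCat.{u} :=
  Γ(G.left, ⊤)

/-!
Write `A = F[G]`, a Hopf algebra of finite type over `F`, and let `m` be the ideal of the unit. The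
argument works directly with the `m`-adic filtration and never passes to `F(i)`: connectedness of
`G_{F(i)}` is used only to know that `G`, its image under a surjection, is connected.

*Invariant vector fields.* Translating a derivation to the unit and back shows that every derivation
of `A` into an `A`-module is a combination of finitely many invariant derivations `D i : A → A`,
which at the unit are dual to elements `x i ∈ m` inducing a basis of `m / m ^ 2`
(`exists_invariant_frame`).

*Functions flat at the unit vanish.* The ideal `J = ⨅ k, m ^ k` is stable under the `D i`. Let `p`
be a maximal ideal containing `J`. Since `F` has characteristic zero, `A ⧸ p` is formally smooth
over `F`, so the projection `p → p / p ^ 2` extends to a derivation of `A`, which is a combination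
`∑ y i • D i` with `y i ∈ p`. This Euler vector field acts on `p ^ k / p ^ (k + 1)` as
multiplication by `k`, and it follows by induction that `J ≤ p ^ k` for all `k`
(`le_pow_of_stable`). By Krull's intersection theorem `J` is zero near every closed point of its zero
locus, so it is generated by an idempotent (`eq_bot_of_forall_le_pow`), and connectedness gives
`J = 0` (`iInf_augIdeal_pow_eq_bot`).

*Leading forms.* Applying the `D i` shows that the homogeneous polynomials of degree `k` in the
`x i` inject into `m ^ k / m ^ (k + 1)` (`eq_zero_of_aeval_mem_pow`), so the associated graded ring
of `A` at `m` is a polynomial ring over `F`. As `J = 0`, each nonzero element of `A` has a nonzero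
leading form. Leading forms multiply, so `A` is a domain. In a vanishing sum of squares the forms of
least degree would give a vanishing sum of squares of polynomials over `F`; evaluating at points of
`F ^ n` and using that `-1` is not a sum of squares in `F`, these forms are all zero.
-/

/-! ### Convolution and derivations -/

open scoped TensorProduct in
/-- The convolution `a ↦ ∑ φ(a₍₁₎) • θ(a₍₂₎)` of a linear endomorphism `φ` of a bialgebra `A` with
a linear map `θ` to an `A`-module; the coefficients are taken on the left tensor factor. -/
noncomputable def convSMul {F A M : Type*} [CommRing F] [CommRing A] [Bialgebra F A]
    [AddCommGroup M] [Module F M] [Module A M] [IsScalarTower F A M]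
    (φ : A →ₗ[F] A) (θ : A →ₗ[F] M) : A →ₗ[F] M :=
  TensorProduct.lift (((Algebra.lsmul F F M).toLinearMap.comp φ).compl₂ θ) ∘ₗ Coalgebra.comul

section Convolution

open Coalgebra

variable {F A M : Type*} [CommRing F] [CommRing A] [AddCommGroup M]

section Bialgebra

variable [Bialgebra F A] [Module F M] [Module A M] [IsScalarTower F A M]

lemma convSMul_apply (φ : A →ₗ[F] A) (θ : A →ₗ[F] M) {a : A} {ι : Type*} (r : Repr F a ι) :
    convSMul φ θ a = ∑ i ∈ r.index, φ (r.left i) • θ (r.right i) := by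
  simp [convSMul, ← r.eq]

lemma convSMul_mem (φ : A →ₗ[F] A) (θ : A →ₗ[F] M) (N : Submodule A M) (h : ∀ a, θ a ∈ N)
    (a : A) : convSMul φ θ a ∈ N := by
  rw [convSMul_apply φ θ (ℛ F a)]
  exact N.sum_mem fun i _ => N.smul_mem _ (h _)

lemma convSMul_mul (φ : A →ₐ[F] A) (θ : A →ₗ[F] M) {a b : A} {ι κ : Type*} (r : Repr F a ι)
    (s : Repr F b κ) : convSMul φ.toLinearMap θ (a * b) = ∑ i ∈ r.index, ∑ j ∈ s.index,
      (φ (r.left i) * φ (s.left j)) • θ (r.right i * s.right j) := by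
  simp [convSMul, Bialgebra.comul_mul, ← r.eq, ← s.eq, Finset.sum_mul_sum, mul_smul]

lemma convSMul_assoc (φ ψ : A →ₗ[F] A) (θ : A →ₗ[F] M) :
    convSMul φ (convSMul ψ θ) = convSMul (convSMul φ ψ) θ := by
  let T : TensorProduct F A (TensorProduct F A A) →ₗ[F] M :=
    TensorProduct.lift (((Algebra.lsmul F F M).toLinearMap.comp φ).compl₂
      (TensorProduct.lift (((Algebra.lsmul F F M).toLinearMap.comp ψ).compl₂ θ)))
  have h1 : convSMul φ (convSMul ψ θ) = T ∘ₗ (comul.lTensor A) ∘ₗ comul := by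
    rw [convSMul, ← LinearMap.comp_assoc]
    congr 1
    ext x y
    simp [T, convSMul]
  have h2 : convSMul (convSMul φ ψ) θ =
      (T ∘ₗ (TensorProduct.assoc F A A A).toLinearMap) ∘ₗ (comul.rTensor A) ∘ₗ comul := by
    rw [convSMul, ← LinearMap.comp_assoc]
    congr 1
    ext x y
    simp only [convSMul, TensorProduct.AlgebraTensorModule.curry_apply,
      LinearMap.restrictScalars_self, TensorProduct.curry_apply, TensorProduct.lift.tmul,
      LinearMap.compl₂_apply, LinearMap.comp_apply, LinearMap.rTensor_tmul]
    induction (comul x : TensorProduct F A A) with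
    | zero => simp
    | add p q hp hq => simp only [map_add, LinearMap.add_apply, hp, hq, TensorProduct.add_tmul]
    | tmul p q => simp [T]
  rw [h1, h2, LinearMap.comp_assoc]
  congr 1
  exact Coalgebra.coassoc.symm

lemma convSMul_counit (θ : A →ₗ[F] M) :
    convSMul (Algebra.linearMap F A ∘ₗ counit) θ = θ := by
  ext a
  rw [convSMul_apply _ _ (ℛ F a)]
  conv_rhs => rw [← sum_counit_smul (ℛ F a)]
  simp [map_sum]

/-- Convolving the identity with a derivation at the unit (a map satisfying the Leibniz rule for
`A` acting through the counit) gives a derivation. -/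
lemma convSMul_id_mul (θ : A →ₗ[F] M)
    (h : ∀ a b, θ (a * b) = (counit a : F) • θ b + (counit b : F) • θ a) (a b : A) :
    convSMul LinearMap.id θ (a * b) =
      a • convSMul LinearMap.id θ b + b • convSMul LinearMap.id θ a := by
  have key := convSMul_mul (AlgHom.id F A) θ (ℛ F a) (ℛ F b)
  rw [show (AlgHom.id F A).toLinearMap = LinearMap.id from rfl] at key
  rw [key]
  simp only [h, smul_add, Finset.sum_add_distrib, AlgHom.id_apply]
  have collapse : ∀ c : A, c = ∑ i ∈ (ℛ F c).index,
      (counit ((ℛ F c).right i) : F) • (ℛ F c).left i := fun c => by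
    simpa only [map_sum, TensorProduct.lift.tmul, LinearMap.flip_apply, LinearMap.lsmul_apply,
      one_smul] using
      (congrArg (TensorProduct.lift (LinearMap.lsmul F A).flip) (sum_tmul_counit_eq (ℛ F c))).symm
  congr 1
  · conv_rhs => rw [convSMul_apply _ _ (ℛ F b), collapse a, Finset.sum_smul]
    refine Finset.sum_congr rfl fun i _ => ?_
    rw [Finset.smul_sum]
    refine Finset.sum_congr rfl fun j _ => ?_
    rw [mul_smul, smul_comm _ (counit _ : F), smul_comm _ (counit _ : F), smul_assoc]
    rfl
  · conv_rhs => rw [convSMul_apply _ _ (ℛ F a), collapse b, Finset.sum_smul]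
    rw [Finset.sum_comm]
    refine Finset.sum_congr rfl fun j _ => ?_
    rw [Finset.smul_sum]
    refine Finset.sum_congr rfl fun i _ => ?_
    rw [mul_comm, mul_smul, smul_comm _ (counit _ : F), smul_comm _ (counit _ : F), smul_assoc]
    rfl

end Bialgebra

section HopfAlgebra

variable [HopfAlgebra F A] [Module F M] [Module A M] [IsScalarTower F A M]

/-- Translating a derivation to the unit, `a ↦ ∑ S(a₍₁₎) • δ(a₍₂₎)`, gives a derivation at the
unit. -/
lemma convSMul_antipode_mul (δ : Derivation F A M) (a b : A) :
    convSMul (HopfAlgebra.antipode F) δ.toLinearMap (a * b) =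
      (counit a : F) • convSMul (HopfAlgebra.antipode F) δ.toLinearMap b +
        (counit b : F) • convSMul (HopfAlgebra.antipode F) δ.toLinearMap a := by
  have key := convSMul_mul (HopfAlgebra.antipodeAlgHom F A) δ.toLinearMap (ℛ F a) (ℛ F b)
  rw [show (HopfAlgebra.antipodeAlgHom F A).toLinearMap = HopfAlgebra.antipode F from rfl] at key
  rw [key]
  have collapse : ∀ (c : A) (m : M), (counit c : F) • m = ∑ i ∈ (ℛ F c).index,
      (HopfAlgebra.antipode F ((ℛ F c).left i) * (ℛ F c).right i) • m := fun c m => by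
    rw [← Finset.sum_smul, HopfAlgebra.sum_antipode_mul_eq_algebraMap_counit, algebraMap_smul]
  simp only [Derivation.coeFn_coe, Derivation.leibniz, smul_add,
    Finset.sum_add_distrib, HopfAlgebra.antipodeAlgHom_apply]
  congr 1
  · rw [collapse a]
    refine Finset.sum_congr rfl fun i _ => ?_
    rw [convSMul_apply _ _ (ℛ F b), Finset.smul_sum]
    refine Finset.sum_congr rfl fun j _ => ?_
    simp only [← mul_smul]
    congr 1
    ring
  · rw [Finset.sum_comm, collapse b]
    refine Finset.sum_congr rfl fun j _ => ?_
    rw [convSMul_apply _ _ (ℛ F a), Finset.smul_sum]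
    refine Finset.sum_congr rfl fun i _ => ?_
    simp only [← mul_smul]
    congr 1
    ring

/-- Translating to the unit and back is the identity. -/
lemma convSMul_id_antipode (θ : A →ₗ[F] M) :
    convSMul LinearMap.id (convSMul (HopfAlgebra.antipode F) θ) = θ := by
  rw [convSMul_assoc]
  convert! convSMul_counit θ using 2
  ext a
  rw [convSMul_apply _ _ (ℛ F a)]
  simpa using HopfAlgebra.sum_mul_antipode_eq_algebraMap_counit (ℛ F a)

end HopfAlgebra

end Convolution

/-! ### The frame of invariant vector fields -/

section InvariantFrame

open Coalgebra

variable {F A : Type*} [Field F] [CommRing A] [HopfAlgebra F A]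

variable (F A) in
/-- The augmentation ideal, that is, the maximal ideal of the unit section. -/
noncomputable def augIdeal : Ideal A := RingHom.ker (Bialgebra.counitAlgHom F A)

lemma mem_augIdeal {a : A} : a ∈ augIdeal F A ↔ (counit a : F) = 0 := Iff.rfl

lemma sub_counit_mem_augIdeal (a : A) : a - algebraMap F A (counit a) ∈ augIdeal F A := by
  simp [mem_augIdeal]

/-- A linear map satisfying the Leibniz rule at the unit kills the square of the augmentation
ideal. -/
lemma eq_zero_of_mem_augIdeal_sq {M : Type*} [AddCommGroup M] [Module F M] {θ : A →ₗ[F] M}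
    (h : ∀ a b, θ (a * b) = (counit a : F) • θ b + (counit b : F) • θ a) {a : A}
    (ha : a ∈ augIdeal F A ^ 2) : θ a = 0 := by
  rw [pow_two] at ha
  induction ha using Submodule.mul_induction_on' with
  | mem_mul_mem x hx y hy => simp [h, mem_augIdeal.1 hx, mem_augIdeal.1 hy]
  | add x _ y _ hx hy => rw [map_add, hx, hy, add_zero]

lemma map_one_eq_zero_of_leibniz_counit {M : Type*} [AddCommGroup M] [Module F M] {θ : A →ₗ[F] M}
    (h : ∀ a b, θ (a * b) = (counit a : F) • θ b + (counit b : F) • θ a) : θ 1 = 0 := by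
  simpa using h 1 1

/-- Coordinates at the unit: finitely many elements `x i` of the augmentation ideal `m` and
functionals `d i` satisfying the Leibniz rule at the unit, inducing dual bases of `m / m ^ 2` and
its dual. -/
lemma exists_dual_coordinates [IsNoetherianRing A] :
    ∃ (n : ℕ) (x : Fin n → A) (d : Fin n → A →ₗ[F] F),
      (∀ i, x i ∈ augIdeal F A) ∧
      (∀ i a b, d i (a * b) = (counit a : F) • d i b + (counit b : F) • d i a) ∧
      (∀ i j, d i (x j) = if i = j then 1 else 0) ∧
      (∀ a, a - algebraMap F A (counit a) - ∑ i, d i a • x i ∈ augIdeal F A ^ 2) := by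
  let m := augIdeal F A
  -- `A` acts on `m / m ^ 2` through the counit, so finiteness over `A` gives finiteness over `F`.
  have hsmul : ∀ (a : A) (v : m.Cotangent), a • v = (counit a : F) • v := fun a v => by
    rw [← algebraMap_smul A (counit a : F) v, ← sub_eq_zero, ← sub_smul]
    exact Ideal.Cotangent.smul_eq_zero_of_mem (sub_counit_mem_augIdeal a) v
  have : Module.Finite F m.Cotangent := by
    have : Module.Finite A m.Cotangent := .of_surjective m.toCotangent m.toCotangent_surjective
    obtain ⟨S, hS⟩ := Module.Finite.fg_top (R := A) (M := m.Cotangent)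
    refine ⟨S, eq_top_iff.2 fun v _ => ?_⟩
    have hv : v ∈ Submodule.span A (S : Set m.Cotangent) := hS ▸ Submodule.mem_top
    induction hv using Submodule.span_induction with
    | mem x h => exact Submodule.subset_span h
    | zero => exact zero_mem _
    | add x y _ _ hx hy => exact add_mem (hx trivial) (hy trivial)
    | smul a x _ hx => exact hsmul a x ▸ Submodule.smul_mem _ _ (hx trivial)
  let b := Module.finBasis F m.Cotangent
  let π : A →ₗ[F] m.Cotangent :=
    (m.toCotangent.restrictScalars F) ∘ₗ LinearMap.codRestrict (m.restrictScalars F)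
      (LinearMap.id - Algebra.linearMap F A ∘ₗ counit) sub_counit_mem_augIdeal
  have hπ : ∀ a (ha : a - algebraMap F A (counit a) ∈ m),
    π a = m.toCotangent ⟨a - algebraMap F A (counit a), ha⟩ := fun a ha => rfl
  have hπm : ∀ a : m, π a = m.toCotangent a := fun a => by
    rw [hπ _ (sub_counit_mem_augIdeal _)]
    congr
    simp [mem_augIdeal.1 a.2]
  choose x hx using fun i => m.toCotangent_surjective (b i)
  have hπmul : ∀ a c, π (a * c) = (counit a : F) • π c + (counit c : F) • π a := by
    intro a c
    have h1 : (counit a : F) • π c + (counit c : F) • π a = m.toCotangent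
        ((counit a : F) • ⟨_, sub_counit_mem_augIdeal c⟩ +
          (counit c : F) • ⟨_, sub_counit_mem_augIdeal a⟩) := by
      rw [map_add, LinearMap.map_smul_of_tower, LinearMap.map_smul_of_tower]
      rfl
    rw [h1, hπ _ (sub_counit_mem_augIdeal _), Ideal.toCotangent_eq]
    have h2 := Ideal.mul_mem_mul (sub_counit_mem_augIdeal (F := F) a)
      (sub_counit_mem_augIdeal (F := F) c)
    rw [← pow_two] at h2
    convert! h2 using 1
    simp only [Submodule.coe_add, Submodule.coe_smul_of_tower, Algebra.smul_def,
      Bialgebra.counit_mul, map_mul]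
    ring
  have hπF : ∀ r : F, π (algebraMap F A r) = 0 := fun r => by
    rw [hπ _ (sub_counit_mem_augIdeal _), Ideal.toCotangent_eq_zero]
    simp
  refine ⟨_, fun i => x i, fun i => b.coord i ∘ₗ π, fun i => (x i).2, fun i a c => ?_, ?_, ?_⟩
  · simp [hπmul]
  · intro i j
    simp [hπm, hx, Finsupp.single_apply, eq_comm]
  · intro a
    have hmem : a - algebraMap F A (counit a) - ∑ i, (b.coord i ∘ₗ π) a • (x i : A) ∈ m :=
      m.sub_mem (sub_counit_mem_augIdeal a) (m.sum_mem fun i _ => by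
        rw [Algebra.smul_def]; exact m.mul_mem_left _ (x i).2)
    rw [show (a - algebraMap F A (counit a) - ∑ i, (b.coord i ∘ₗ π) a • (x i : A)) =
      ((⟨_, hmem⟩ : m) : A) from rfl, ← Ideal.toCotangent_eq_zero, ← hπm]
    simp [hπm, hx, hπF, b.sum_repr]

/-- An affine group scheme of finite type has a finite frame of invariant vector fields `D i`,
dual at the unit to coordinates `x i`. Every derivation `δ` into a module is a combination of them,
with coefficients in any submodule `N` containing the values of `δ`. -/
lemma exists_invariant_frame [IsNoetherianRing A] :
    ∃ (n : ℕ) (x : Fin n → A) (D : Fin n → Derivation F A A),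
      (∀ i, x i ∈ augIdeal F A) ∧
      (∀ i j, D i (x j) - (if i = j then 1 else 0) ∈ augIdeal F A) ∧
      (∀ a ∈ augIdeal F A, a - ∑ i, (counit (D i a) : F) • x i ∈ augIdeal F A ^ 2) ∧
      ∀ (M : Type _) [AddCommGroup M] [Module F M] [Module A M] [IsScalarTower F A M]
        (δ : Derivation F A M) (N : Submodule A M), (∀ a, δ a ∈ N) →
        ∃ v : Fin n → M, (∀ i, v i ∈ N) ∧ ∀ a, δ a = ∑ i, D i a • v i := by
  obtain ⟨n, x, d, hx, hd, hdx, hdec⟩ := exists_dual_coordinates (F := F) (A := A)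
  let θ : Fin n → A →ₗ[F] A := fun i => Algebra.linearMap F A ∘ₗ d i
  have hθ : ∀ i a b, θ i (a * b) = (counit a : F) • θ i b + (counit b : F) • θ i a := by
    intro i a b
    simp [θ, hd, Algebra.smul_def]
  let D : Fin n → Derivation F A A := fun i =>
    Derivation.mk' (convSMul LinearMap.id (θ i)) (convSMul_id_mul (θ i) (hθ i))
  have hD : ∀ i a, D i a = convSMul LinearMap.id (θ i) a := fun i a => rfl
  have hcounit : ∀ i a, (counit (D i a) : F) = d i a := by
    intro i a
    rw [hD, convSMul_apply _ _ (ℛ F a)]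
    conv_rhs => rw [← sum_counit_smul (ℛ F a)]
    simp [θ]
  refine ⟨n, x, D, hx, fun i j => ?_, fun a ha => ?_, ?_⟩
  · rw [mem_augIdeal, map_sub, hcounit, hdx]
    split_ifs <;> simp
  · simpa [mem_augIdeal.1 ha, hcounit] using hdec a
  · intro M _ _ _ _ δ N hN
    let η := convSMul (HopfAlgebra.antipode F) δ.toLinearMap
    refine ⟨fun i => η (x i), fun i => convSMul_mem _ _ N hN _, fun a => ?_⟩
    have hη : ∀ a, η a = ∑ i, d i a • η (x i) := by
      intro a
      have h0 := eq_zero_of_mem_augIdeal_sq (convSMul_antipode_mul δ) (hdec a)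
      have h1 : η (algebraMap F A (counit a)) = 0 := by
        rw [Algebra.algebraMap_eq_smul_one, map_smul,
          map_one_eq_zero_of_leibniz_counit (convSMul_antipode_mul δ), smul_zero]
      change η _ = 0 at h0
      rw [map_sub, map_sub, h1, sub_zero, sub_eq_zero, map_sum] at h0
      simpa using h0
    calc δ a = convSMul LinearMap.id η a := by
          rw [convSMul_id_antipode]; rfl
      _ = ∑ i, D i a • η (x i) := by
          rw [convSMul_apply _ _ (ℛ F a)]
          simp_rw [hD, convSMul_apply _ _ (ℛ F a), Finset.sum_smul]
          rw [Finset.sum_comm]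
          refine Finset.sum_congr rfl fun i _ => ?_
          rw [hη, Finset.smul_sum]
          refine Finset.sum_congr rfl fun j _ => ?_
          simp [θ, mul_smul]

end InvariantFrame

/-! ### Ideals stable under vector fields -/

section Euler

variable {F A : Type*} [CommRing F] [CommRing A] [Algebra F A] {ι : Type*} [Fintype ι]

lemma Derivation.apply_mem_pow (D : Derivation F A A) (I : Ideal A) (k : ℕ) :
    ∀ a ∈ I ^ (k + 1), D a ∈ I ^ k := by
  induction k with
  | zero => simp
  | succ k ih =>
    intro a ha
    rw [pow_succ'] at ha
    induction ha using Submodule.mul_induction_on' with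
    | mem_mul_mem x hx y hy =>
      rw [D.leibniz, smul_eq_mul, smul_eq_mul, pow_succ' I k]
      exact add_mem (Ideal.mul_mem_mul hx (ih y hy))
        (Ideal.mul_mem_right _ _ ((pow_succ' I k).symm ▸ hy))
    | add x _ y _ hx hy => rw [map_add]; exact add_mem hx hy

/-- If the vector field `E = ∑ y i • D i` acts on `I / I ^ 2` as the identity, then it acts on
`I ^ k / I ^ (k + 1)` as multiplication by `k`. -/
lemma natCast_mul_sub_euler_mem_pow {I : Ideal A} {y : ι → A} {D : ι → Derivation F A A}
    (hy : ∀ i, y i ∈ I) (h : ∀ a ∈ I, a - ∑ i, D i a * y i ∈ I ^ 2) (k : ℕ) :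
    ∀ a ∈ I ^ k, k * a - ∑ i, D i a * y i ∈ I ^ (k + 1) := by
  induction k with
  | zero =>
    intro a _
    simpa using sum_mem fun i _ => I.mul_mem_left _ (hy i)
  | succ k ih =>
    intro a ha
    rw [pow_succ'] at ha
    induction ha using Submodule.mul_induction_on' with
    | mem_mul_mem b hb c hc =>
      have h1 : (b - ∑ i, D i b * y i) * c ∈ I ^ (k + 1 + 1) := by
        rw [show k + 1 + 1 = 2 + k by ring, pow_add]
        exact Ideal.mul_mem_mul (h b hb) hc
      have h2 : b * (k * c - ∑ i, D i c * y i) ∈ I ^ (k + 1 + 1) := by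
        rw [pow_succ' I (k + 1)]
        exact Ideal.mul_mem_mul hb (ih c hc)
      convert! add_mem h1 h2 using 1
      simp only [Derivation.leibniz, smul_eq_mul, add_mul, Finset.sum_add_distrib, sub_mul, mul_sub,
        Finset.sum_mul, Finset.mul_sum]
      rw [Finset.sum_congr rfl fun i _ => mul_assoc b (D i c) (y i),
        Finset.sum_congr rfl fun i _ => show c * D i b * y i = D i b * y i * c by ring]
      push_cast
      ring
    | add b _ c _ hb hc =>
      convert! add_mem hb hc using 1
      simp only [map_add, add_mul, Finset.sum_add_distrib]
      ring

/-- An ideal stable under the vector fields `D i` and vanishing at a point where they span the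
tangent space vanishes there to infinite order. -/
lemma le_pow_of_stable {F A : Type*} [Field F] [CharZero F] [CommRing A] [Algebra F A]
    {I J : Ideal A} {y : ι → A} {D : ι → Derivation F A A}
    (hy : ∀ i, y i ∈ I) (h : ∀ a ∈ I, a - ∑ i, D i a * y i ∈ I ^ 2) (hJI : J ≤ I)
    (hJ : ∀ i, ∀ a ∈ J, D i a ∈ J) (k : ℕ) : J ≤ I ^ k := by
  induction k with
  | zero => simp
  | succ k ih =>
    -- The step from `k = 0` is the hypothesis; afterwards `k` is invertible in `F`.
    rcases Nat.eq_zero_or_pos k with rfl | hk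
    · simpa using hJI
    intro a ha
    have h1 : (k : A) * a ∈ I ^ (k + 1) := by
      have h2 : ∑ i, D i a * y i ∈ I ^ (k + 1) := sum_mem fun i _ => by
        rw [pow_succ]
        exact Ideal.mul_mem_mul (ih (hJ i a ha)) (hy i)
      simpa using add_mem (natCast_mul_sub_euler_mem_pow hy h k a (ih ha)) h2
    have h3 : (algebraMap F A (k : F)⁻¹) * ((k : A) * a) = a := by
      rw [← mul_assoc, ← map_natCast (algebraMap F A), ← map_mul,
        inv_mul_cancel₀ (by exact_mod_cast hk.ne'), map_one, one_mul]
    rw [← h3]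
    exact Ideal.mul_mem_left _ _ h1

end Euler

section Krull

variable {A : Type*} [CommRing A] [IsNoetherianRing A]

/-- In a noetherian ring without nontrivial idempotents, a proper ideal `J` is zero as soon as it
vanishes to infinite order at each closed point of its zero locus: such a `J` is locally `0` or the
unit ideal, hence generated by an idempotent. -/
lemma eq_bot_of_forall_le_pow (hA : ∀ e : A, IsIdempotentElem e → e = 0 ∨ e = 1) {J : Ideal A}
    (hJ : J ≠ ⊤) (h : ∀ p : Ideal A, p.IsMaximal → J ≤ p → ∀ k, J ≤ p ^ k) : J = ⊥ := by
  have htop : J.annihilator ⊔ J = ⊤ := by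
    by_contra hne
    obtain ⟨p, hp, hle⟩ := Ideal.exists_le_maximal _ hne
    have hJp := le_sup_right.trans hle
    have hJpJ : J ≤ p • J := fun a ha => by
      have ha' : a ∈ (⨅ i : ℕ, p ^ i • ⊤ : Submodule A A) := by
        simp only [smul_eq_mul, Ideal.mul_top, Submodule.mem_iInf]
        exact fun i => h p hp hJp i ha
      obtain ⟨r, hr⟩ := (p.mem_iInf_smul_pow_eq_bot_iff a).1 ha'
      rw [← hr]
      exact Submodule.smul_mem_smul r.2 ha
    -- Nakayama: `r ≡ 1` modulo `p` kills `J`, contradicting `J.annihilator ≤ p`.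
    obtain ⟨r, hr, hrJ⟩ := Submodule.exists_sub_one_mem_and_smul_eq_zero_of_fg_of_le_smul p J
      (IsNoetherian.noetherian J) hJpJ
    have hrp : r ∈ p := hle (le_sup_left (a := J.annihilator) (Submodule.mem_annihilator.2 hrJ))
    exact hp.ne_top ((Ideal.eq_top_iff_one p).2 (by simpa using sub_mem hrp hr))
  have hidem : IsIdempotentElem J := by
    refine le_antisymm Ideal.mul_le_left fun a ha => ?_
    obtain ⟨r, hr, j, hj, hrj⟩ := Submodule.mem_sup.1 (htop ▸ Submodule.mem_top : (1 : A) ∈ _)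
    rw [← one_mul a, ← hrj, add_mul, ← smul_eq_mul r a, Submodule.mem_annihilator.1 hr a ha,
      zero_add]
    exact Ideal.mul_mem_mul hj ha
  obtain ⟨e, he, rfl⟩ := (Ideal.isIdempotentElem_iff_of_fg J (IsNoetherian.noetherian J)).1 hidem
  rcases hA e he with rfl | rfl
  · simp
  · exact absurd Ideal.span_singleton_one hJ

end Krull

/-- At a closed point `p` with residue field formally smooth over the base, there is a derivation
`A → A ⧸ p ^ 2` with values in `p / p ^ 2` extending the projection `p → p / p ^ 2`. -/
lemma exists_derivation_quotient_sq {F A : Type*} [CommRing F] [CommRing A] [Algebra F A]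
    (p : Ideal A) [Algebra.FormallySmooth F (A ⧸ p)] :
    ∃ δ : Derivation F A (A ⧸ p ^ 2),
      (∀ a, δ a ∈ Submodule.map (Ideal.Quotient.mkₐ A (p ^ 2)).toLinearMap p) ∧
      ∀ a ∈ p, δ a = Ideal.Quotient.mk (p ^ 2) a := by
  let π : (A ⧸ p ^ 2) →ₐ[F] A ⧸ p := Ideal.Quotient.factorₐ F (Ideal.pow_le_self two_ne_zero)
  have hker : ∀ z, π z = 0 → ∃ a ∈ p, Ideal.Quotient.mk (p ^ 2) a = z := fun z hz => by
    obtain ⟨a, rfl⟩ := Ideal.Quotient.mk_surjective z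
    exact ⟨a, Ideal.Quotient.eq_zero_iff_mem.1 hz, rfl⟩
  have hker_mul : ∀ z w, π z = 0 → π w = 0 → z * w = 0 := fun z w hz hw => by
    obtain ⟨a, ha, rfl⟩ := hker z hz
    obtain ⟨b, hb, rfl⟩ := hker w hw
    rw [← map_mul, Ideal.Quotient.eq_zero_iff_mem, pow_two]
    exact Ideal.mul_mem_mul ha hb
  have hsurj : Function.Surjective π :=
    Ideal.Quotient.factor_surjective (Ideal.pow_le_self two_ne_zero)
  have hnil : IsNilpotent (RingHom.ker (π : (A ⧸ p ^ 2) →+* A ⧸ p)) := by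
    refine ⟨2, ?_⟩
    rw [Ideal.zero_eq_bot, eq_bot_iff, sq (RingHom.ker _), Ideal.mul_le]
    exact fun z hz w hw => hker_mul z w hz hw
  let σ := Algebra.FormallySmooth.liftOfSurjective (AlgHom.id F (A ⧸ p)) π hsurj hnil
  have hσ : ∀ z, π (σ z) = z := fun z =>
    Algebra.FormallySmooth.liftOfSurjective_apply (AlgHom.id F (A ⧸ p)) π hsurj hnil z
  -- `δ` is `a ↦ a - σ a`, for `σ` an algebra section of `A ⧸ p ^ 2 → A ⧸ p`.
  let τ : A →ₐ[F] A ⧸ p ^ 2 := σ.comp (Ideal.Quotient.mkₐ F p)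
  let q : A →ₐ[F] A ⧸ p ^ 2 := Ideal.Quotient.mkₐ F (p ^ 2)
  have hqτ : ∀ a, π (q a - τ a) = 0 := fun a => by
    rw [map_sub, sub_eq_zero]
    exact (hσ (Ideal.Quotient.mk p a)).symm
  have hsmul : ∀ (a : A) (z : A ⧸ p ^ 2), a • z = q a * z := fun a z => Algebra.smul_def a z
  refine ⟨Derivation.mk' (q.toLinearMap - τ.toLinearMap) fun a b => ?_, fun a => ?_, fun a ha => ?_⟩
  · have h0 := hker_mul _ _ (hqτ a) (hqτ b)
    simp only [LinearMap.sub_apply, AlgHom.toLinearMap_apply, hsmul, map_mul]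
    linear_combination -h0
  · obtain ⟨b, hb, hba⟩ := hker _ (hqτ a)
    exact ⟨b, hb, hba⟩
  · have : τ a = 0 := by
      change σ (Ideal.Quotient.mk p a) = 0
      rw [Ideal.Quotient.eq_zero_iff_mem.2 ha, map_zero]
    change q a - τ a = _
    rw [this, sub_zero]
    rfl

/-! ### Leading forms at a point -/

section LeadingForms

open MvPolynomial

variable {F A : Type*} [Field F] [CommRing A] [Algebra F A] {n : ℕ} {m : Ideal A} {x : Fin n → A}

lemma aeval_mem_pow (hx : ∀ i, x i ∈ m) {k : ℕ} {P : MvPolynomial (Fin n) F}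
    (hP : P.IsHomogeneous k) : aeval x P ∈ m ^ k := by
  rw [P.as_sum, map_sum]
  refine sum_mem fun s hs => ?_
  rw [aeval_monomial]
  refine Ideal.mul_mem_left _ _ ?_
  have hs' : ∑ i, s i = k := by
    rw [← hP (mem_support_iff.1 hs), ← Finsupp.degree_eq_sum]
    exact congrArg (fun f => f s) (Finsupp.degree_eq_weight_one (R := ℕ))
  rw [Finsupp.prod_fintype _ _ (by simp), ← hs', ← Finset.prod_pow_eq_pow_sum]
  exact Ideal.prod_mem_prod fun i _ => Ideal.pow_mem_pow (hx i) _

/-- Existence of leading forms: `m ^ k` is spanned modulo `m ^ (k + 1)` by the monomials of degree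
`k` in the `x i`. -/
lemma exists_homogeneous_sub_mem_pow (hx : ∀ i, x i ∈ m)
    (h0 : ∀ a : A, ∃ c : F, a - algebraMap F A c ∈ m)
    (h1 : ∀ a ∈ m, ∃ c : Fin n → F, a - ∑ i, c i • x i ∈ m ^ 2) (k : ℕ) :
    ∀ a ∈ m ^ k, ∃ P : MvPolynomial (Fin n) F, P.IsHomogeneous k ∧
      a - aeval x P ∈ m ^ (k + 1) := by
  induction k with
  | zero =>
    intro a _
    obtain ⟨c, hc⟩ := h0 a
    exact ⟨C c, isHomogeneous_C _ _, by simpa using hc⟩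
  | succ k ih =>
    intro a ha
    rw [pow_succ'] at ha
    induction ha using Submodule.mul_induction_on' with
    | mem_mul_mem b hb c hc =>
      obtain ⟨β, hβ⟩ := h1 b hb
      obtain ⟨P, hP, hcP⟩ := ih c hc
      let L : MvPolynomial (Fin n) F := ∑ i, C (β i) * X i
      have hL : L.IsHomogeneous 1 := IsHomogeneous.sum _ _ _ fun i _ => by
        simpa using (isHomogeneous_C _ (β i)).mul (isHomogeneous_X F i)
      have hLx : aeval x L = ∑ i, β i • x i := by simp [L, Algebra.smul_def]
      refine ⟨L * P, by simpa [add_comm] using hL.mul hP, ?_⟩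
      have e1 : (b - aeval x L) * c ∈ m ^ (k + 1 + 1) := by
        rw [show k + 1 + 1 = 2 + k by ring, pow_add]
        exact Ideal.mul_mem_mul (hLx ▸ hβ) hc
      have e2 : aeval x L * (c - aeval x P) ∈ m ^ (k + 1 + 1) := by
        rw [pow_succ' m (k + 1)]
        exact Ideal.mul_mem_mul (by simpa using aeval_mem_pow hx hL) hcP
      convert! add_mem e1 e2 using 1
      rw [map_mul]
      ring
    | add b _ c _ hb hc =>
      obtain ⟨P, hP, hbP⟩ := hb
      obtain ⟨Q, hQ, hcQ⟩ := hc
      refine ⟨P + Q, hP.add hQ, ?_⟩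
      convert! add_mem hbP hcQ using 1
      rw [map_add]
      ring

lemma derivation_aeval (D : Derivation F A A) (P : MvPolynomial (Fin n) F) :
    D (aeval x P) = ∑ i, aeval x (pderiv i P) * D (x i) := by
  induction P using MvPolynomial.induction_on with
  | C c => simp
  | add P Q hP hQ => simp [hP, hQ, add_mul, Finset.sum_add_distrib]
  | mul_X P j h =>
    simp only [map_mul, aeval_X, Derivation.leibniz, h, smul_eq_mul, pderiv_X, map_add, add_mul,
      Finset.sum_add_distrib, Finset.mul_sum, Pi.single_apply, apply_ite (aeval x),
      map_zero, mul_ite, mul_one, mul_zero, ite_mul, zero_mul, Finset.sum_ite_eq, Finset.mem_univ,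
      if_true]
    simp only [mul_assoc]

/-- In characteristic zero, the monomials of degree `k` in coordinates `x i` with dual vector
fields `D i` are linearly independent in `m ^ k / m ^ (k + 1)`. -/
lemma eq_zero_of_aeval_mem_pow [CharZero F] {D : Fin n → Derivation F A A} (hm : m ≠ ⊤)
    (hx : ∀ i, x i ∈ m) (hD : ∀ i j, D i (x j) - (if i = j then 1 else 0) ∈ m) (k : ℕ) :
    ∀ P : MvPolynomial (Fin n) F, P.IsHomogeneous k → aeval x P ∈ m ^ (k + 1) → P = 0 := by
  induction k with
  | zero =>
    intro P hP h
    rw [← totalDegree_zero_iff_isHomogeneous, totalDegree_eq_zero_iff_eq_C] at hP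
    rw [hP] at h ⊢
    by_contra hc
    have hc' : coeff 0 P ≠ 0 := fun h0 => hc (by rw [h0, map_zero])
    refine hm (Ideal.eq_top_of_isUnit_mem _ (by simpa using h) ?_)
    exact (IsUnit.mk0 _ hc').map (algebraMap F A)
  | succ k ih =>
    intro P hP h
    have hpd : ∀ i, pderiv i P = 0 := fun i => by
      refine ih _ (by simpa using hP.pderiv (i := i)) ?_
      have e1 : D i (aeval x P) ∈ m ^ (k + 1) := (D i).apply_mem_pow m _ _ h
      have e2 : ∑ j, aeval x (pderiv j P) * (D i (x j) - (if i = j then 1 else 0)) ∈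
          m ^ (k + 1) := sum_mem fun j _ => by
        rw [pow_succ]
        exact Ideal.mul_mem_mul (aeval_mem_pow hx (by simpa using hP.pderiv (i := j))) (hD i j)
      convert! sub_mem e1 e2 using 1
      rw [derivation_aeval]
      simp [mul_sub]
    -- Euler's identity: all partial derivatives vanish, hence so does `(k + 1) • P`.
    have := hP.sum_X_mul_pderiv
    simp only [hpd, mul_zero, Finset.sum_const_zero] at this
    rw [eq_comm, smul_eq_zero] at this
    simpa using this

end LeadingForms

lemma eq_zero_of_sum_sq_eq_zero_of_isSemireal {F : Type*} [Field F] [IsSemireal F] {ι : Type*}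
    (s : Finset ι) (f : ι → F) (h : ∑ i ∈ s, f i ^ 2 = 0) : ∀ i ∈ s, f i = 0 := by
  classical
  intro i hi
  by_contra hne
  have h1 : IsSumSq (∑ j ∈ s.erase i, (f j / f i) * (f j / f i)) :=
    IsSumSq.sum_mul_self _ _
  apply IsSemireal.one_add_ne_zero h1
  rw [← Finset.add_sum_erase s _ hi] at h
  have : (f i ^ 2) * (1 + ∑ j ∈ s.erase i, (f j / f i) * (f j / f i)) = 0 := by
    rw [← h, mul_add, mul_one, Finset.mul_sum]
    congr 1
    refine Finset.sum_congr rfl fun j _ => ?_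
    field_simp
  exact (mul_eq_zero.1 this).resolve_left (pow_ne_zero 2 hne)

/-! ### Hopf algebras without nontrivial idempotents -/

section HopfAlgebra

variable {F : Type u} [Field F] {A : Type u} [CommRing A] [HopfAlgebra F A]

lemma augIdeal_ne_top : augIdeal F A ≠ ⊤ := fun h => by
  simpa [mem_augIdeal] using (Ideal.eq_top_iff_one _).1 h

/-- Cartier's theorem for connected groups, in the following form: functions vanishing to infinite
order at the unit are zero. -/
lemma iInf_augIdeal_pow_eq_bot [CharZero F] [Algebra.FiniteType F A]
    (hA : ∀ e : A, IsIdempotentElem e → e = 0 ∨ e = 1) : ⨅ k, augIdeal F A ^ k = ⊥ := by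
  have : IsNoetherianRing A := Algebra.FiniteType.isNoetherianRing F A
  obtain ⟨n, x, D, -, -, -, hframe⟩ := exists_invariant_frame.{u, u, u} (F := F) (A := A)
  have hJ : ⨅ k, augIdeal F A ^ k ≤ augIdeal F A := (iInf_le _ 1).trans_eq (pow_one _)
  refine eq_bot_of_forall_le_pow hA (fun h => augIdeal_ne_top (F := F) (A := A)
    (top_le_iff.1 (h ▸ hJ))) fun p hp hle => ?_
  let := Ideal.Quotient.field p
  have : Algebra.FormallySmooth F (A ⧸ p) := Algebra.FormallySmooth.of_perfectField
  obtain ⟨δ, hδ, hδp⟩ := exists_derivation_quotient_sq (F := F) p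
  obtain ⟨v, hv, hδv⟩ := hframe _ δ _ hδ
  choose y hy hyv using hv
  refine le_pow_of_stable (D := D) hy (fun a ha => ?_) hle fun i a ha => ?_
  · rw [← Ideal.Quotient.eq_zero_iff_mem, map_sub, ← hδp a ha, hδv, map_sum, sub_eq_zero]
    refine Finset.sum_congr rfl fun i _ => ?_
    rw [← hyv, map_mul, Algebra.smul_def]
    rfl
  · rw [Ideal.mem_iInf] at ha ⊢
    exact fun k => (D i).apply_mem_pow _ k a (ha (k + 1))

/-- The commutative algebra behind the theorem: the coordinate ring of a connected affine group
scheme of finite type over a field in which `-1` is not a sum of squares is a real algebra. -/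
theorem isRealAlgebra_of_hopfAlgebra [IsSemireal F] [Algebra.FiniteType F A]
    (hA : ∀ e : A, IsIdempotentElem e → e = 0 ∨ e = 1) : IsRealAlgebra A := by
  have : IsNoetherianRing A := Algebra.FiniteType.isNoetherianRing F A
  obtain ⟨n, x, D, hx, hD, hdec, -⟩ := exists_invariant_frame.{u, u, u} (F := F) (A := A)
  set m := augIdeal F A
  have hm : m ≠ ⊤ := augIdeal_ne_top
  have hbot : ∀ a : A, (∀ k, a ∈ m ^ k) → a = 0 := fun a ha => by
    simpa [m, iInf_augIdeal_pow_eq_bot hA] using (Ideal.mem_iInf (I := fun k => m ^ k)).2 ha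
  have hform := exists_homogeneous_sub_mem_pow hx
    (fun a => ⟨_, sub_counit_mem_augIdeal (F := F) a⟩) (fun a ha => ⟨_, hdec a ha⟩)
  have hzero := eq_zero_of_aeval_mem_pow (F := F) hm hx hD
  -- Nonzero elements have nonzero leading forms.
  have horder : ∀ a : A, a ≠ 0 → ∃ k, ∃ P : MvPolynomial (Fin n) F, P.IsHomogeneous k ∧ P ≠ 0 ∧
      a ∈ m ^ k ∧ a - MvPolynomial.aeval x P ∈ m ^ (k + 1) := by
    intro a ha
    have hex : ∃ k, a ∉ m ^ k := by
      by_contra! h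
      exact ha (hbot a h)
    classical
    have hpos : Nat.find hex ≠ 0 := fun h => by simpa [h] using Nat.find_spec hex
    obtain ⟨k, hk⟩ := Nat.exists_eq_succ_of_ne_zero hpos
    have hak : a ∈ m ^ k := by
      simpa using Nat.find_min hex (show k < Nat.find hex by omega)
    obtain ⟨P, hP, haP⟩ := hform k a hak
    refine ⟨k, P, hP, ?_, hak, haP⟩
    rintro rfl
    exact Nat.find_spec hex (by simpa [hk] using haP)
  have : Nontrivial A := ⟨⟨0, 1, fun h => hm ((Ideal.eq_top_iff_one m).2 (h ▸ m.zero_mem))⟩⟩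
  have : NoZeroDivisors A := by
    refine ⟨fun {a b} hab => ?_⟩
    by_contra! hne
    obtain ⟨k, P, hP, hP0, hak, haP⟩ := horder a hne.1
    obtain ⟨l, Q, hQ, hQ0, -, hbQ⟩ := horder b hne.2
    refine mul_ne_zero hP0 hQ0 (hzero (k + l) _ (hP.mul hQ) ?_)
    have e1 : a * (b - MvPolynomial.aeval x Q) ∈ m ^ (k + l + 1) := by
      rw [add_assoc, pow_add]
      exact Ideal.mul_mem_mul hak hbQ
    have e2 : (a - MvPolynomial.aeval x P) * MvPolynomial.aeval x Q ∈ m ^ (k + l + 1) := by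
      rw [add_right_comm, pow_add]
      exact Ideal.mul_mem_mul haP (aeval_mem_pow hx hQ)
    convert! neg_mem (add_mem e1 e2) using 1
    rw [map_mul]
    linear_combination hab
  refine ⟨IsDomain.mk, fun r f hf j => ?_⟩
  -- The degree `k` forms of the `f j` satisfy the same relation, so the order of every `f j` exceeds
  -- `k`; by induction it is infinite.
  suffices h : ∀ k j, f j ∈ m ^ k from hbot _ fun k => h k j
  intro k
  induction k with
  | zero => simp
  | succ k ih =>
    choose P hP hfP using fun j => hform k (f j) (ih j)
    have hS : ∑ j, P j ^ 2 = 0 := by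
      refine hzero (k * 2) _ (MvPolynomial.IsHomogeneous.sum _ _ _ fun j _ => (hP j).pow 2) ?_
      rw [← neg_mem_iff, ← zero_sub, ← hf, map_sum, ← Finset.sum_sub_distrib]
      refine sum_mem fun j _ => ?_
      rw [map_pow, sq_sub_sq, mul_comm k, two_mul, add_assoc, pow_add]
      exact Ideal.mul_mem_mul (add_mem (ih j) (aeval_mem_pow hx (hP j))) (hfP j)
    have hP0 : ∀ j, P j = 0 := fun j => MvPolynomial.funext fun c => by
      have := congrArg (MvPolynomial.eval c) hS
      simp only [map_sum, map_pow, map_zero] at this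
      simpa using eq_zero_of_sum_sq_eq_zero_of_isSemireal _ _ this j (Finset.mem_univ j)
    intro j
    simpa [hP0] using hfP j

end HopfAlgebra

/-! ### Affine group schemes -/

lemma PrimeSpectrum.eq_zero_or_one_of_isIdempotentElem {A : Type*} [CommRing A]
    [PreconnectedSpace (PrimeSpectrum A)] (e : A) (he : IsIdempotentElem e) : e = 0 ∨ e = 1 := by
  obtain ⟨c, hc⟩ := (isIdempotentElemEquivClopens (R := A)).symm.surjective ⟨e, he⟩
  replace hc := congrArg Subtype.val hc
  rcases _root_.isClopen_iff.1 c.isClopen with h | h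
  · rw [show c = ⊥ from TopologicalSpace.Clopens.ext h,
      isIdempotentElemEquivClopens_symm_bot] at hc
    exact Or.inl hc.symm
  · rw [show c = ⊤ from TopologicalSpace.Clopens.ext h,
      isIdempotentElemEquivClopens_symm_top] at hc
    exact Or.inr hc.symm

/-- The projection `G_{F(i)} → G` is surjective, so `G` is connected if `G_{F(i)}` is. -/
lemma connectedSpace_left_of_baseChangeI {F : Type u} [Field F]
    (G : Over (Spec (CommRingCat.of F))) (hG : ConnectedSpace (baseChangeI G)) :
    ConnectedSpace G.left := by
  have : Nontrivial (AdjoinI F) := AdjoinRoot.nontrivial _ (by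
    rw [show (Polynomial.X ^ 2 + 1 : F[X]) = Polynomial.X ^ 2 + Polynomial.C 1 by simp,
      Polynomial.degree_X_pow_add_C two_pos]
    norm_num)
  have : Surjective (Spec.map (CommRingCat.ofHom (algebraMap F (AdjoinI F)))) := by
    infer_instance
  let q : baseChangeI G ⟶ G.left := pullback.snd _ _
  have hq : Function.Surjective q := q.surjective
  exact hq.connectedSpace q.continuous

/-- The Hopf algebra structure on the global sections of an affine group scheme `G`, where `G` is
given as an object over `Spec R` instead of a scheme with a chosen structure morphism. -/
noncomputable abbrev hopfAlgebraGlobalSections {R : CommRingCat.{u}} (G : Over (Spec R)) [GrpObj G]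
    [IsAffine G.left] : HopfAlgebra R Γ(G.left, ⊤) :=
  letI : GrpObj (G.left.asOver (Spec R)) := inferInstanceAs (GrpObj G)
  inferInstance

/-- Here a linear algebraic group over `F` is an affine group scheme `G` of finite type over `F`
(an affine scheme over `F` is quasi-compact, so locally of finite type means of finite type). -/
theorem lemma2p2 {F : Type u} [Field F] [IsRealClosed F]
    (G : Over (Spec (CommRingCat.of F))) [GrpObj G] [IsAffine G.left]
    [LocallyOfFiniteType G.hom] (hG : ConnectedSpace (baseChangeI G)) :
    IsRealAlgebra (coordinateRing G) := by
  have : ConnectedSpace G.left := connectedSpace_left_of_baseChangeI G hG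
  have : ConnectedSpace (PrimeSpectrum Γ(G.left, ⊤)) :=
    G.left.isoSpec.hom.homeomorph.surjective.connectedSpace G.left.isoSpec.hom.continuous
  let _ : HopfAlgebra F Γ(G.left, ⊤) := hopfAlgebraGlobalSections G
  have : Algebra.FiniteType F Γ(G.left, ⊤) := by
    rw [← RingHom.finiteType_algebraMap]
    -- The algebra structure of the Hopf algebra is given by the structure morphism of `G`.
    change (Spec.fullyFaithful.preimage (G.left.isoSpec.inv ≫ G.hom)).unop.hom.FiniteType
    rw [← HasRingHomProperty.Spec_iff (P := @LocallyOfFiniteType), Spec.map_preimage_unop]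
    infer_instance
  exact isRealAlgebra_of_hopfAlgebra (F := F)
    PrimeSpectrum.eq_zero_or_one_of_isIdempotentElem
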